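/- Let $X$ be a quasi-Polish space, that is, a countably based space whose topology is generated by the balls $\{y : d(x,y)<\varepsilon\}$ of a quasi-metric $d$ ($d\ge 0$; $x=y$ iff $d(x,y)=d(y,x)=0$; $d(x,z)\le d(x,y)+d(y,z)$) which is Smyth-complete: every sequence $(x_n)$ such that for each $\varepsilon>0$ there is $N$ with $d(x_n,x_m)<\varepsilon$ for all $N\le n\le m$ converges with respect to the metric $\max(d(x,y),d(y,x))$. Let $Y$ be a countably based $T_0$-space. A surjective partial function $\rho\colon\subseteq\omega^\omega\to Z$ onto a topological space $Z$ is an admissible representation if it is continuous on its domain and every partial function $\varphi\colon\subseteq\omega^\omega\to Z$ that is continuous on its domain is of the form $\varphi=\rho\circ F$ for a partial function $F\colon\subseteq\omega^\omega\to\omega^\omega$ that is continuous on its domain (equality of partial functions includes equality of domains). Let $\rho_X,\rho_Y$ be admissible representations of $X$ and $Y$, and let $f\colon X\to Y$ be a total function. For a partial function $j\colon\subseteq\omega^\omega\to\omega^\omega$, $f$ is called $j$-realizable if there is a partial function $F\colon\subseteq\omega^\omega\to\omega^\omega$, continuous on its domain, with $f\circ\rho_X=\rho_Y\circ j\circ F$.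 Let $\langle\xi_n\rangle_{n\in\omega}\in\omega^\omega$ code the sequence $(\xi_n)_n$ of elements of $\omega^\omega$ by $\langle\xi_n\rangle_{n}(\pi(n,m))=\xi_n(m)$ for a standard pairing bijection $\pi\colon\omega^2\to\omega$, and for each ordinal $\alpha<\omega_1$ fix any injection $\langle\cdot\rangle_\alpha\colon\{\beta : \beta<\alpha\}\to\omega$. For $k\in\omega$ and $\xi\in\omega^\omega$ let $k\diamond\xi$ be $\xi$ with $k$ prepended. * $\langle\xi_n\rangle_n\in\mathrm{dom}(j_\Delta)$ iff $(\exists n)(\forall m\ge n)\,\xi_m=\xi_n$, and then $j_\Delta(\langle\xi_n\rangle_n)=\lim_n\xi_n$. * For $\alpha<\omega_1$, $\mathrm{dom}(j_\alpha)$ consists of the $\langle\langle\beta_n\rangle_\alpha\diamond\xi_n\rangle_n$ with $\alpha>\beta_n\ge\beta_{n+1}$ for all $n$, and $\beta_n\ne\beta_{n+1}$ whenever $\xi_n\neq\xi_{n+1}$; the value of $j_\alpha$ there is $\lim_n\xi_n$. Let $\mathcal L_0(f)=X$, let $\mathcal L_{\alpha+1}(f)$ be the closure in $X$ of the set of points of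 $\mathcal L_\alpha(f)$ at which $f|_{\mathcal L_\alpha(f)}$ is discontinuous, and let $\mathcal L_\alpha(f)=\bigcap_{\beta<\alpha}\mathcal L_\beta(f)$ for limit $\alpha$; let $\mathrm{Lev}(f)$ be the least $\alpha$ with $\mathcal L_\alpha(f)=\emptyset$, or $\infty$ if there is none. Then $f$ is $j_\Delta$-realizable if and only if $f$ is $j_\alpha$-realizable for some $\alpha<\omega_1$; and $f$ is $j_\Delta$-realizable if and only if $\mathrm{Lev}(f)=\alpha$ for some $\alpha<\omega_1$. -/

import Mathlib

universe u v

/-- Baire space, with the product topology of the discrete topology on `ℕ`. -/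
abbrev Baire : Type := ℕ → ℕ

/-! ### Represented spaces and realizability -/

/-- A partial function is continuous if it is continuous on its domain, where the domain carries
the subspace topology. (The domain need not be open, unlike in `PContinuous`.) -/
def PartialContinuous {A : Type u} {B : Type v} [TopologicalSpace A] [TopologicalSpace B]
    (F : A →. B) : Prop :=
  Continuous F.asSubtype

/-- A representation of a set is a surjective partial function from Baire space onto it. -/
def IsRepresentation {X : Type u} (ρ : Baire →. X) : Prop :=
  ∀ x : X, ∃ p : Baire, x ∈ ρ p

/-- A representation of a topological space is admissible if it is continuous and every partial
continuous function from Baire space into the space factors through it by a partial continuous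
function. Equality of partial functions includes equality of domains. -/
structure IsAdmissible {X : Type u} [TopologicalSpace X] (ρ : Baire →. X) : Prop where
  isRepresentation : IsRepresentation ρ
  continuous : PartialContinuous ρ
  factors : ∀ φ : Baire →. X, PartialContinuous φ →
    ∃ F : Baire →. Baire, PartialContinuous F ∧ φ = ρ.comp F

/-- `F` realizes `f`: `f ∘ ρX = ρY ∘ F` as partial functions. -/
def Realizes {X : Type u} {Y : Type v} (ρX : Baire →. X) (ρY : Baire →. Y)
    (F : Baire →. Baire) (f : X →. Y) : Prop :=
  f.comp ρX = ρY.comp F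

/-- `f` is `j`-realizable: there is a partial continuous `F` such that `j ∘ F` realizes `f`. -/
def JRealizable {X : Type u} {Y : Type v} (ρX : Baire →. X) (ρY : Baire →. Y)
    (j : Baire →. Baire) (f : X →. Y) : Prop :=
  ∃ F : Baire →. Baire, PartialContinuous F ∧ Realizes ρX ρY (j.comp F) f

/-! ### The jump operators -/

/-- The `n`-th member `ξₙ` of the sequence coded by `p = ⟨ξ₀, ξ₁, …⟩`, where `⟨ξ₀, ξ₁, …⟩` is the
element of Baire space whose value at `Nat.pair n m` is `ξₙ(m)`. This coding is a bijection
between sequences in Baire space and Baire space. -/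
def seqEntry (p : Baire) (n : ℕ) : Baire := fun m => p (Nat.pair n m)

/-- The sequence with its first entry removed. -/
def dropHead (ξ : Baire) : Baire := fun m => ξ (m + 1)

/-- The operator `j_Δ`: `⟨ξ₀, ξ₁, …⟩` is in the domain iff `ξₙ` is eventually constant, and is then
mapped to the limit of the `ξₙ`. -/
noncomputable def jDelta : Baire →. Baire := fun p =>
  { Dom := ∃ n, ∀ m ≥ n, seqEntry p m = seqEntry p n
    get := fun _ => Filter.limUnder Filter.atTop (fun n => seqEntry p n) }

/-- The operator `j_α`, for an ordinal `α` whose predecessors are coded by natural numbers through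
the injection `e`. An element of Baire space coding the sequence of the `⟨βₙ⟩ ⋄ ξₙ` (the code of
`βₙ` followed by `ξₙ`) is in the domain iff `α > βₙ ≥ βₙ₊₁` for all `n`, and `ξₙ ≠ ξₙ₊₁` implies
`βₙ ≠ βₙ₊₁`; it is then mapped to the limit of the `ξₙ`. -/
noncomputable def jOrd {α : Ordinal.{u}} (e : Set.Iio α ↪ ℕ) : Baire →. Baire := fun p =>
  { Dom := ∃ β : ℕ → Set.Iio α,
      (∀ n, seqEntry p n 0 = e (β n)) ∧
      (∀ n, β (n + 1) ≤ β n) ∧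
      (∀ n, dropHead (seqEntry p n) ≠ dropHead (seqEntry p (n + 1)) → β n ≠ β (n + 1))
    get := fun _ => Filter.limUnder Filter.atTop (fun n => dropHead (seqEntry p n)) }

/-! ### Quasi-Polish spaces -/

/-- A quasi-metric: a distance satisfying all the axioms of a metric except symmetry, where the
points `x` and `y` are separated by `d x y` and `d y x` together. -/
structure IsQuasiMetric {X : Type u} (d : X → X → ℝ) : Prop where
  nonneg : ∀ x y, 0 ≤ d x y
  eq_iff : ∀ x y, x = y ↔ d x y = 0 ∧ d y x = 0
  triangle : ∀ x y z, d x z ≤ d x y + d y z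

/-- The given topology is the one generated by the balls `{y | d x y < ε}`. -/
def InducesTopology {X : Type u} [t : TopologicalSpace X] (d : X → X → ℝ) : Prop :=
  t = TopologicalSpace.generateFrom {B | ∃ (x : X) (ε : ℝ), 0 < ε ∧ B = {y | d x y < ε}}

/-- Smyth-completeness: every sequence that is Cauchy, in the sense that `d (xₙ) (xₘ)` is
eventually small for `n ≤ m`, converges for the metric `max (d x y) (d y x)`. -/
def SmythComplete {X : Type u} (d : X → X → ℝ) : Prop :=
  ∀ s : ℕ → X, (∀ ε > 0, ∃ N, ∀ n m, N ≤ n → n ≤ m → d (s n) (s m) < ε) →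
    ∃ x, Filter.Tendsto (fun n => max (d x (s n)) (d (s n) x)) Filter.atTop (nhds 0)

/-- A quasi-Polish space: countably based, with topology induced by a Smyth-complete
quasi-metric. -/
structure IsQuasiPolish (X : Type u) [TopologicalSpace X] : Prop where
  secondCountable : SecondCountableTopology X
  exists_quasiMetric : ∃ d : X → X → ℝ, IsQuasiMetric d ∧ InducesTopology d ∧ SmythComplete d

/-! ### Levels of discontinuity -/

/-- The sets `𝓛_α(f)`: `𝓛_0(f)` is the whole space, `𝓛_{α+1}(f)` is the closure of the set of points
of `𝓛_α(f)` at which the restriction of `f` to `𝓛_α(f)` is discontinuous, and intersections are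
taken at limits. -/
noncomputable def discLevel {X : Type u} {Y : Type v} [TopologicalSpace X] [TopologicalSpace Y]
    (f : X → Y) (α : Ordinal.{u}) : Set X :=
  Ordinal.limitRecOn α Set.univ
    (fun _ A => closure {x | x ∈ A ∧ ¬ ContinuousWithinAt f A x})
    (fun α _ A => ⋂ (β : Ordinal.{u}) (h : β < α), A β h)

open Classical in
/-- The level `Lev(f)`: the least `α` with `𝓛_α(f) = ∅` if there is one, and `∞` otherwise. -/
noncomputable def Lev {X : Type u} {Y : Type v} [TopologicalSpace X] [TopologicalSpace Y]
    (f : X → Y) : WithTop Ordinal.{u} :=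
  if ∃ α, discLevel f α = ∅ then ((sInf {α | discLevel f α = ∅} : Ordinal.{u}) : WithTop Ordinal.{u})
  else ⊤

/-! The three conditions are linked by a cycle. From `jOrd` to `jDelta`: a weakly decreasing
sequence of ordinals stabilises, and the approximations `ξₙ` may change only where the ordinals
drop, so forgetting the ordinals leaves an eventually constant sequence.

From `jDelta` to countable level: by second countability the levels are stationary from some
countable `α` on. If `A = discLevel f α` were nonempty, the discontinuities of `f` on `A` would be
dense in `A`. But `A` is closed, hence quasi-Polish, hence the image of a closed `D ⊆ Baire` under
an open continuous map `δ` (`IsQuasiPolish.exists_isOpenMap`). Lifting `δ` to names and applying the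
realizer gives eventually constant sequences depending continuously on `D`. By Baire category they
are constant from one fixed index on throughout some nonempty open set. There `f ∘ δ` is continuous,
and openness of `δ` makes `f` continuous on a nonempty relatively open part of `A`, a contradiction.

From countable level to `jOrd`: reading longer prefixes of a name `p` gives decreasing guesses
`levelGuess` of the `γ` for which the point lies in level `γ` but not in level `γ + 1`. On this
difference `f` is continuous and so has a realizer `ψ γ`; the output at stage `n` is the current
guess together with `ψ` of it at `p`. Since `ψ γ` is also evaluated before the guess is right, it
must be continuous at every name of a point outside level `γ + 1`; `exists_extension_continuousAt`
arranges this. -/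

open Set Filter Topology

/-! ### Partial functions and admissible representations -/

/-- The partial function with domain `S` given there by `g`. -/
def PFun.ofSubtype {A : Type u} {B : Type v} (S : Set A) (g : S → B) : A →. B :=
  fun a => ⟨a ∈ S, fun h => g ⟨a, h⟩⟩

theorem PFun.mem_ofSubtype {A : Type u} {B : Type v} {S : Set A} {g : S → B} {a : A} {b : B} :
    b ∈ PFun.ofSubtype S g a ↔ ∃ h : a ∈ S, g ⟨a, h⟩ = b :=
  Iff.rfl

theorem partialContinuous_ofSubtype {A : Type u} {B : Type v} [TopologicalSpace A]
    [TopologicalSpace B] {S : Set A} {g : S → B} (hg : Continuous g) :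
    PartialContinuous (PFun.ofSubtype S g) :=
  hg

theorem PFun.mem_asSubtype {A : Type u} {B : Type v} (F : A →. B) (a : F.Dom) :
    F.asSubtype a ∈ F a :=
  Part.get_mem _

theorem PFun.mem_comp {A B C : Type*} {g : B →. C} {f : A →. B} {a : A} {c : C} :
    c ∈ g.comp f a ↔ ∃ b ∈ f a, c ∈ g b := by
  rw [PFun.comp_apply]
  exact Part.mem_bind_iff

/-- A continuous function on a subset of Baire space lifts through an admissible
representation. -/
theorem IsAdmissible.exists_lift {Z : Type u} [TopologicalSpace Z] {ρ : Baire →. Z}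
    (hρ : IsAdmissible ρ) {S : Set Baire} {g : S → Z} (hg : Continuous g) :
    ∃ G : S → Baire, Continuous G ∧ ∀ s, g s ∈ ρ (G s) := by
  obtain ⟨F, hF, h⟩ := hρ.factors (PFun.ofSubtype S g) (partialContinuous_ofSubtype hg)
  have key : ∀ s : S, ∃ q ∈ F s, g s ∈ ρ q := fun s => by
    have h1 : g s ∈ PFun.ofSubtype S g s := ⟨s.2, rfl⟩
    rw [h] at h1
    exact PFun.mem_comp.1 h1
  have hdom : ∀ s : S, (s : Baire) ∈ F.Dom := fun s =>
    (F.mem_dom _).2 ((key s).imp fun q hq => hq.1)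
  refine ⟨fun s => F.asSubtype ⟨s, hdom s⟩, hF.comp (by fun_prop), fun s => ?_⟩
  obtain ⟨q, hq, hgq⟩ := key s
  obtain rfl := PFun.asSubtype_eq_of_mem hq (hdom s)
  exact hgq

/-- A realizer of a total function, seen as a total function on the domain of `ρX`. -/
theorem JRealizable.exists_realizer {X : Type u} {Y : Type v} {ρX : Baire →. X} {ρY : Baire →. Y}
    {j : Baire →. Baire} {f : X → Y} (h : JRealizable ρX ρY j (f : X →. Y)) :
    ∃ G : ρX.Dom → Baire, Continuous G ∧ ∀ p, ∃ r ∈ j (G p), f (ρX.asSubtype p) ∈ ρY r := by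
  obtain ⟨F, hF, h⟩ := h
  have key : ∀ p : ρX.Dom, ∃ q ∈ F p, ∃ r ∈ j q, f (ρX.asSubtype p) ∈ ρY r := fun p => by
    have h1 : f (ρX.asSubtype p) ∈ (f : X →. Y).comp ρX p :=
      PFun.mem_comp.2 ⟨_, ρX.mem_asSubtype p, by simp⟩
    rw [h] at h1
    obtain ⟨r, hr, hy⟩ := PFun.mem_comp.1 h1
    obtain ⟨q, hq, hr⟩ := PFun.mem_comp.1 hr
    exact ⟨q, hq, r, hr, hy⟩
  have hdom : ∀ s : ρX.Dom, (s : Baire) ∈ F.Dom := fun s =>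
    (F.mem_dom _).2 ((key s).imp fun q hq => hq.1)
  refine ⟨fun s => F.asSubtype ⟨s, hdom s⟩, hF.comp (by fun_prop), fun s => ?_⟩
  obtain ⟨q, hq, r, hr, hy⟩ := key s
  obtain rfl := PFun.asSubtype_eq_of_mem hq (hdom s)
  exact ⟨r, hr, hy⟩

/-- Restricting `G` to exactly the domain of `ρX` is what makes the domains of the two composites
agree. -/
theorem jRealizable_of_realizer {X : Type u} {Y : Type v} {ρX : Baire →. X} {ρY : Baire →. Y}
    {j : Baire →. Baire} {f : X → Y} {G : ρX.Dom → Baire} (hG : Continuous G)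
    (h : ∀ p, ∃ r ∈ j (G p), f (ρX.asSubtype p) ∈ ρY r) :
    JRealizable ρX ρY j (f : X →. Y) := by
  refine ⟨PFun.ofSubtype ρX.Dom G, partialContinuous_ofSubtype hG, PFun.ext fun p y => ?_⟩
  simp only [PFun.mem_comp, PFun.mem_ofSubtype]
  constructor
  · rintro ⟨x, hx, hy⟩
    have hp : p ∈ ρX.Dom := (ρX.mem_dom _).2 ⟨x, hx⟩
    obtain ⟨r, hr, hfr⟩ := h ⟨p, hp⟩
    rw [PFun.asSubtype_eq_of_mem hx] at hfr
    obtain rfl : y = f x := by simpa using hy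
    exact ⟨r, ⟨_, ⟨hp, rfl⟩, hr⟩, hfr⟩
  · rintro ⟨r, ⟨q, ⟨hp, rfl⟩, hr⟩, hy⟩
    obtain ⟨r', hr', hfr⟩ := h ⟨p, hp⟩
    obtain rfl := Part.mem_unique hr hr'
    exact ⟨_, ρX.mem_asSubtype ⟨p, hp⟩, by simpa using Part.mem_unique hy hfr⟩

/-! ### The jump operators -/

theorem limUnder_eq_of_eventually_const {s : ℕ → Baire} {n : ℕ} {r : Baire}
    (h : ∀ m ≥ n, s m = r) : limUnder atTop s = r :=
  (tendsto_const_nhds.congr' ((eventually_ge_atTop n).mono fun m hm => (h m hm).symm)).limUnder_eq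

theorem mem_jDelta {p r : Baire} : r ∈ jDelta p ↔ ∃ n, ∀ m ≥ n, seqEntry p m = r := by
  constructor
  · rintro ⟨⟨n, hn⟩, rfl⟩
    exact ⟨n, fun m hm => (hn m hm).trans (limUnder_eq_of_eventually_const hn).symm⟩
  · rintro ⟨n, hn⟩
    exact ⟨⟨n, fun m hm => (hn m hm).trans (hn n le_rfl).symm⟩,
      limUnder_eq_of_eventually_const hn⟩

theorem Antitone.exists_eventually_eq {β : Type u} [LinearOrder β] [WellFoundedLT β] {s : ℕ → β}
    (hs : Antitone s) : ∃ n, ∀ m ≥ n, s m = s n := by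
  obtain ⟨_, ⟨n, rfl⟩, hn⟩ := wellFounded_lt.has_min (range s) ⟨_, mem_range_self 0⟩
  exact ⟨n, fun m hm => le_antisymm (hs hm) (not_lt.1 (hn _ (mem_range_self m)))⟩

/-- The entries can change only where the ordinals strictly drop, which happens finitely often. -/
theorem exists_forall_eq_of_mem_jOrd {α : Ordinal.{u}} {e : Iio α ↪ ℕ} {p r : Baire}
    (h : r ∈ jOrd e p) : ∃ n, ∀ m ≥ n, dropHead (seqEntry p m) = r := by
  obtain ⟨⟨β, -, hanti, hne⟩, rfl⟩ := h
  obtain ⟨n, hn⟩ := (antitone_nat_of_succ_le hanti).exists_eventually_eq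
  have h1 : ∀ m ≥ n, dropHead (seqEntry p m) = dropHead (seqEntry p n) := fun m hm => by
    induction m, hm using Nat.le_induction with
    | base => rfl
    | succ m hm ih =>
      by_contra hc
      refine hne m (fun h => hc (h.symm.trans ih)) ?_
      rw [hn m hm, hn (m + 1) (hm.trans m.le_succ)]
  exact ⟨n, fun m hm => (h1 m hm).trans (limUnder_eq_of_eventually_const h1).symm⟩

/-- The sequence coded by `p` with the first entry of each member removed. -/
def dropHeads (p : Baire) : Baire := fun k => p (Nat.pair k.unpair.1 (k.unpair.2 + 1))

theorem continuous_dropHeads : Continuous dropHeads :=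
  continuous_pi fun _ => continuous_apply _

theorem seqEntry_dropHeads (p : Baire) (n : ℕ) :
    seqEntry (dropHeads p) n = dropHead (seqEntry p n) := by
  ext m
  simp [seqEntry, dropHeads, dropHead]

theorem JRealizable.jDelta_of_jOrd {X : Type u} {Y : Type v} {ρX : Baire →. X} {ρY : Baire →. Y}
    {f : X → Y} {α : Ordinal.{u}} {e : Iio α ↪ ℕ} (h : JRealizable ρX ρY (jOrd e) (f : X →. Y)) :
    JRealizable ρX ρY jDelta (f : X →. Y) := by
  obtain ⟨G, hG, h⟩ := h.exists_realizer
  refine jRealizable_of_realizer (continuous_dropHeads.comp hG) fun p => ?_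
  obtain ⟨r, hr, hy⟩ := h p
  refine ⟨r, mem_jDelta.2 ?_, hy⟩
  simpa only [Function.comp, seqEntry_dropHeads] using exists_forall_eq_of_mem_jOrd hr

/-- The code of the sequence of the `a n ⋄ ξ n`. -/
def codeSeq (a : ℕ → ℕ) (ξ : ℕ → Baire) : Baire :=
  fun k => Nat.casesOn k.unpair.2 (a k.unpair.1) (ξ k.unpair.1)

theorem seqEntry_codeSeq_zero (a : ℕ → ℕ) (ξ : ℕ → Baire) (n : ℕ) :
    seqEntry (codeSeq a ξ) n 0 = a n := by
  simp [seqEntry, codeSeq]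

theorem dropHead_seqEntry_codeSeq (a : ℕ → ℕ) (ξ : ℕ → Baire) (n : ℕ) :
    dropHead (seqEntry (codeSeq a ξ) n) = ξ n := by
  ext m
  simp [seqEntry, codeSeq, dropHead]

theorem continuous_codeSeq {S : Type u} [TopologicalSpace S] {a : S → ℕ → ℕ} {ξ : S → ℕ → Baire}
    (ha : ∀ n, Continuous fun s => a s n) (hξ : ∀ n, Continuous fun s => ξ s n) :
    Continuous fun s => codeSeq (a s) (ξ s) := by
  refine continuous_pi fun k => ?_
  unfold codeSeq
  cases k.unpair.2 with
  | zero => exact ha _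
  | succ m => exact (continuous_apply m).comp (hξ _)

theorem mem_jOrd_codeSeq {α : Ordinal.{u}} {e : Iio α ↪ ℕ} {β : ℕ → Iio α} {ξ : ℕ → Baire}
    {r : Baire} (hβ : Antitone β) (hξ : ∀ n, β n = β (n + 1) → ξ n = ξ (n + 1)) {n : ℕ}
    (hn : ∀ m ≥ n, ξ m = r) : r ∈ jOrd e (codeSeq (fun n => e (β n)) ξ) := by
  refine ⟨⟨β, fun n => seqEntry_codeSeq_zero _ _ n, fun n => hβ n.le_succ, fun n h h' => h ?_⟩, ?_⟩
  · simpa only [dropHead_seqEntry_codeSeq] using hξ n h'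
  · exact limUnder_eq_of_eventually_const (n := n) fun m hm => by
      rw [dropHead_seqEntry_codeSeq, hn m hm]

/-! ### Quasi-Polish spaces as open continuous images -/

theorem IsQuasiMetric.self_eq_zero {X : Type u} {d : X → X → ℝ} (hd : IsQuasiMetric d) (x : X) :
    d x x = 0 :=
  ((hd.eq_iff x x).1 rfl).1

theorem InducesTopology.isOpen_iff {X : Type u} [TopologicalSpace X] {d : X → X → ℝ}
    (hd : IsQuasiMetric d) (h : InducesTopology d) {U : Set X} :
    IsOpen U ↔ ∀ x ∈ U, ∃ ε > 0, {y | d x y < ε} ⊆ U := by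
  constructor
  · intro hU
    rw [h] at hU
    induction hU with
    | basic s hs =>
      obtain ⟨z, ε, hε, rfl⟩ := hs
      intro x hx
      refine ⟨ε - d z x, sub_pos.2 hx, fun y hy => ?_⟩
      have := hd.triangle z x y
      simp only [mem_ofPred_eq] at *
      linarith
    | univ => exact fun x _ => ⟨1, one_pos, subset_univ _⟩
    | inter s t _ _ hs ht =>
      intro x hx
      obtain ⟨ε, hε, h1⟩ := hs x hx.1
      obtain ⟨η, hη, h2⟩ := ht x hx.2
      exact ⟨min ε η, lt_min hε hη, fun y hy =>
        have hy : d x y < min ε η := hy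
        ⟨h1 (lt_min_iff.1 hy).1, h2 (lt_min_iff.1 hy).2⟩⟩
    | sUnion S _ hS =>
      rintro x ⟨s, hs, hx⟩
      obtain ⟨ε, hε, h1⟩ := hS s hs x hx
      exact ⟨ε, hε, h1.trans (subset_sUnion_of_mem hs)⟩
  · intro hU
    choose! ε hε hsub using hU
    have : U = ⋃ x ∈ U, {y | d x y < ε x} := by
      refine Subset.antisymm (fun x hx => mem_iUnion₂.2 ⟨x, hx, ?_⟩) (iUnion₂_subset hsub)
      simpa [hd.self_eq_zero] using hε x hx
    rw [this]
    refine isOpen_biUnion fun x hx => ?_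
    rw [h]
    exact TopologicalSpace.isOpen_generateFrom_of_mem ⟨x, ε x, hε x hx, rfl⟩

theorem IsQuasiMetric.inducesTopology_of_isOpen_iff {X : Type u} [TopologicalSpace X]
    {d : X → X → ℝ} (hd : IsQuasiMetric d)
    (h : ∀ U : Set X, IsOpen U ↔ ∀ x ∈ U, ∃ ε > 0, {y | d x y < ε} ⊆ U) : InducesTopology d := by
  refine le_antisymm (le_generateFrom ?_) fun U hU => ?_
  · rintro _ ⟨z, ε, hε, rfl⟩
    refine (h _).2 fun x hx => ⟨ε - d z x, sub_pos.2 hx, fun y hy => ?_⟩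
    have := hd.triangle z x y
    simp only [mem_ofPred_eq] at *
    linarith
  · exact (@InducesTopology.isOpen_iff X (TopologicalSpace.generateFrom _) d hd rfl U).2
      ((h U).1 hU)

/-- A closed subspace of a quasi-Polish space is quasi-Polish. -/
theorem IsQuasiPolish.of_isClosed {X : Type u} [TopologicalSpace X] (hX : IsQuasiPolish X)
    {A : Set X} (hA : IsClosed A) : IsQuasiPolish A := by
  obtain ⟨hsc, d, hd, ht, hS⟩ := hX
  have hd' : IsQuasiMetric fun x y : A => d x y :=
    ⟨fun x y => hd.nonneg x y, fun x y => Subtype.ext_iff.trans (hd.eq_iff x y),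
      fun x y z => hd.triangle x y z⟩
  refine ⟨inferInstance, fun x y => d x y, hd',
    hd'.inducesTopology_of_isOpen_iff fun U => ⟨?_, fun hU => ?_⟩, fun s hs => ?_⟩
  · rintro ⟨V, hV, rfl⟩ x hx
    obtain ⟨ε, hε, h⟩ := (ht.isOpen_iff hd).1 hV x hx
    exact ⟨ε, hε, fun y hy => h hy⟩
  · choose! ε hε hsub using hU
    have : U = ⋃ x ∈ U, (↑) ⁻¹' {y : X | d x y < ε x} := by
      refine Subset.antisymm (fun x hx => mem_iUnion₂.2 ⟨x, hx, ?_⟩) (iUnion₂_subset hsub)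
      simpa [hd.self_eq_zero] using hε x hx
    rw [this]
    refine isOpen_biUnion fun x hx => IsOpen.preimage continuous_subtype_val ?_
    rw [ht]
    exact TopologicalSpace.isOpen_generateFrom_of_mem ⟨x, ε x, hε x hx, rfl⟩
  · obtain ⟨x, hx⟩ := hS (fun n => s n) hs
    -- A ball about `x` missing `A` would contain late terms of the sequence, since `d x (s n)`
    -- tends to `0`.
    have hxA : x ∈ A := by
      by_contra hxA
      obtain ⟨ε, hε, h⟩ := (ht.isOpen_iff hd).1 hA.isOpen_compl x hxA
      obtain ⟨n, hn⟩ := (hx.eventually (gt_mem_nhds hε)).exists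
      exact h (lt_of_le_of_lt (le_max_left _ _) hn) (s n).2
    exact ⟨⟨x, hxA⟩, hx⟩

/-- In a countably based quasi-metric space, some sequence is dense for the symmetrised metric. -/
theorem IsQuasiMetric.exists_denseSeq {X : Type u} [TopologicalSpace X] [Nonempty X]
    [SecondCountableTopology X] {d : X → X → ℝ} (hd : IsQuasiMetric d) (ht : InducesTopology d) :
    ∃ a : ℕ → X, ∀ x, ∀ ε > 0, ∃ i, d x (a i) < ε ∧ d (a i) x < ε := by
  classical
  let b := TopologicalSpace.countableBasis X
  have hb := TopologicalSpace.isBasis_countableBasis X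
  have : Countable b := (TopologicalSpace.countable_countableBasis X).to_subtype
  -- A centre is chosen in each basic set `B` that fits in a ball about one of its own points. If `x
  -- ∈ B` and `B` lies in the small ball about `x`, then `c ∈ B` bounds `d x c`, and `B` lying in
  -- the ball about `c` bounds `d c x`.
  let c : b × ℕ → X := fun s =>
    if h : ∃ x ∈ (s.1 : Set X), (s.1 : Set X) ⊆ {y | d x y < 1 / (s.2 + 1)} then h.choose
    else Classical.arbitrary X
  have hc : ∀ x, ∀ ε > 0, ∃ s, d x (c s) < ε ∧ d (c s) x < ε := by
    intro x ε hε
    obtain ⟨n, hn⟩ := exists_nat_one_div_lt hε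
    have hop : IsOpen {y | d x y < 1 / ((n : ℝ) + 1)} := by
      rw [ht]
      exact TopologicalSpace.isOpen_generateFrom_of_mem ⟨x, _, by positivity, rfl⟩
    obtain ⟨B, hB, hxB, hsub⟩ := hb.exists_subset_of_mem_open
      (show x ∈ {y | d x y < 1 / ((n : ℝ) + 1)} by
        simp only [mem_ofPred_eq, hd.self_eq_zero]; positivity) hop
    have h : ∃ x ∈ B, B ⊆ {y | d x y < 1 / ((n : ℝ) + 1)} := ⟨x, hxB, hsub⟩
    have hceq : c (⟨B, hB⟩, n) = h.choose := dif_pos h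
    refine ⟨(⟨B, hB⟩, n), ?_, ?_⟩ <;> rw [hceq]
    · exact lt_trans (hsub h.choose_spec.1) hn
    · exact lt_trans (h.choose_spec.2 hxB) hn
  have hne : Nonempty (b × ℕ) := by
    obtain ⟨s, -⟩ := hc (Classical.arbitrary X) 1 one_pos
    exact ⟨s⟩
  obtain ⟨g, hg⟩ := exists_surjective_nat (b × ℕ)
  refine ⟨c ∘ g, fun x ε hε => ?_⟩
  obtain ⟨s, hs⟩ := hc x ε hε
  obtain ⟨i, rfl⟩ := hg s
  exact ⟨i, hs⟩

/-! Fix a sequence `a` of points. The number `k`, seen as a pair of numbers `(i, l)`, codes the formal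
ball with centre `a i` and radius `(1 / 2) ^ l`. -/

/-- The centre of the formal ball coded by `k`. -/
def ballCenter {X : Type u} (a : ℕ → X) (k : ℕ) : X := a k.unpair.1

/-- The radius of the formal ball coded by `k`. -/
noncomputable def ballRadius (k : ℕ) : ℝ := (1 / 2) ^ k.unpair.2

theorem ballRadius_pos (k : ℕ) : 0 < ballRadius k := by
  unfold ballRadius
  positivity

/-- `k'` codes a formal ball strictly inside the one coded by `k`. -/
def BallLT {X : Type u} (d : X → X → ℝ) (a : ℕ → X) (k k' : ℕ) : Prop :=
  d (ballCenter a k) (ballCenter a k') + ballRadius k' < ballRadius k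

/-- The sequences of codes of strictly shrinking formal balls. -/
def shrinkingBalls {X : Type u} (d : X → X → ℝ) (a : ℕ → X) : Set Baire :=
  {p | ∀ n, BallLT d a (p n) (p (n + 1)) ∧ ballRadius (p n) ≤ (1 / 2) ^ n}

theorem isClosed_shrinkingBalls {X : Type u} (d : X → X → ℝ) (a : ℕ → X) :
    IsClosed (shrinkingBalls d a) := by
  unfold shrinkingBalls
  rw [ofPred_forall]
  refine isClosed_iInter fun n => ?_
  have : Continuous fun p : Baire => (p n, p (n + 1)) := by fun_prop
  exact (isClosed_discrete
    {q : ℕ × ℕ | BallLT d a q.1 q.2 ∧ ballRadius q.1 ≤ (1 / 2) ^ n}).preimage this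

/-! ### Convergence and prolongation of shrinking formal balls. -/

section shrinkingBalls

variable {X : Type u} {d : X → X → ℝ} {a : ℕ → X} {p : Baire}

theorem dist_add_ballRadius_le (hd : IsQuasiMetric d) (hp : p ∈ shrinkingBalls d a) {n m : ℕ}
    (h : n ≤ m) :
    d (ballCenter a (p n)) (ballCenter a (p m)) + ballRadius (p m) ≤ ballRadius (p n) := by
  induction m, h using Nat.le_induction with
  | base => simp [hd.self_eq_zero]
  | succ m hm ih =>
    have h1 := (hp m).1
    have h2 := hd.triangle (ballCenter a (p n)) (ballCenter a (p m)) (ballCenter a (p (m + 1)))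
    unfold BallLT at h1
    linarith

theorem exists_ballRadius_lt (hp : p ∈ shrinkingBalls d a) {ε : ℝ} (hε : 0 < ε) :
    ∃ N, ∀ n ≥ N, ballRadius (p n) < ε := by
  obtain ⟨N, hN⟩ := exists_pow_lt_of_lt_one hε (show (1 / 2 : ℝ) < 1 by norm_num)
  exact ⟨N, fun n hn => lt_of_le_of_lt ((hp n).2.trans
    (pow_le_pow_of_le_one (by norm_num) (by norm_num) hn)) hN⟩

theorem exists_tendsto_ballCenter (hd : IsQuasiMetric d) (hS : SmythComplete d)
    (hp : p ∈ shrinkingBalls d a) :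
    ∃ x, ∀ ε > 0, ∃ N, ∀ n ≥ N, d x (ballCenter a (p n)) < ε ∧ d (ballCenter a (p n)) x < ε := by
  obtain ⟨x, hx⟩ := hS (fun n => ballCenter a (p n)) fun ε hε => by
    obtain ⟨N, hN⟩ := exists_ballRadius_lt hp hε
    refine ⟨N, fun n m hn hm => ?_⟩
    have := dist_add_ballRadius_le hd hp hm
    linarith [ballRadius_pos (p m), hN n hn]
  refine ⟨x, fun ε hε => ?_⟩
  obtain ⟨N, hN⟩ := eventually_atTop.1 (hx.eventually (gt_mem_nhds hε))
  exact ⟨N, fun n hn => max_lt_iff.1 (hN n hn)⟩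

/-- The inequality stays strict in the limit because the slack in `BallLT` at step `n` absorbs the
distance from a late centre to `x`. -/
theorem dist_limit_lt_ballRadius (hd : IsQuasiMetric d) (hp : p ∈ shrinkingBalls d a) {x : X}
    (hx : ∀ ε > 0, ∃ N, ∀ n ≥ N, d x (ballCenter a (p n)) < ε ∧ d (ballCenter a (p n)) x < ε)
    (n : ℕ) : d (ballCenter a (p n)) x < ballRadius (p n) := by
  have h1 := (hp n).1
  unfold BallLT at h1
  obtain ⟨N, hN⟩ := hx _ (sub_pos.2 h1)
  have h2 := (hN (max N (n + 1)) (le_max_left _ _)).2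
  have h3 := dist_add_ballRadius_le hd hp (le_max_right N (n + 1))
  have h4 := hd.triangle (ballCenter a (p n)) (ballCenter a (p (n + 1))) x
  have h5 := hd.triangle (ballCenter a (p (n + 1))) (ballCenter a (p (max N (n + 1)))) x
  linarith [ballRadius_pos (p (max N (n + 1)))]

theorem exists_ballLT (hd : IsQuasiMetric d)
    (ha : ∀ x, ∀ ε > 0, ∃ i, d x (a i) < ε ∧ d (a i) x < ε) {y : X} {k : ℕ}
    (hk : d (ballCenter a k) y < ballRadius k) (N : ℕ) :
    ∃ k', BallLT d a k k' ∧ ballRadius k' ≤ (1 / 2) ^ N ∧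
      d (ballCenter a k') y < ballRadius k' ∧ d y (ballCenter a k') < ballRadius k' := by
  -- Half the slack: the detour through `y` to the new centre and the new radius each use up less
  -- than one half.
  obtain ⟨M, hM⟩ := exists_pow_lt_of_lt_one (half_pos (sub_pos.2 hk))
    (show (1 / 2 : ℝ) < 1 by norm_num)
  have hle : ((1 / 2 : ℝ)) ^ (max M N) ≤ (1 / 2) ^ M :=
    pow_le_pow_of_le_one (by norm_num) (by norm_num) (le_max_left _ _)
  obtain ⟨i, h1, h2⟩ := ha y ((1 / 2) ^ (max M N)) (by positivity)
  refine ⟨Nat.pair i (max M N), ?_, ?_, ?_, ?_⟩ <;>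
    simp only [BallLT, ballCenter, ballRadius, Nat.unpair_pair] at *
  · have := hd.triangle (a k.unpair.1) y (a i)
    linarith
  · exact pow_le_pow_of_le_one (by norm_num) (by norm_num) (le_max_right _ _)
  · exact h2
  · exact h1

/-- A finite sequence of shrinking formal balls, the last of which contains `y`, can be prolonged to a
sequence with limit `y`. -/
theorem exists_extension_shrinkingBalls (hd : IsQuasiMetric d)
    (ha : ∀ x, ∀ ε > 0, ∃ i, d x (a i) < ε ∧ d (a i) x < ε) {y : X} {n : ℕ}
    (hp : ∀ i < n, BallLT d a (p i) (p (i + 1))) (hr : ∀ i ≤ n, ballRadius (p i) ≤ (1 / 2) ^ i)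
    (hy : d (ballCenter a (p n)) y < ballRadius (p n)) :
    ∃ q ∈ shrinkingBalls d a, (∀ i ≤ n, q i = p i) ∧
      ∀ ε > 0, ∃ N, ∀ n ≥ N, d y (ballCenter a (q n)) < ε ∧ d (ballCenter a (q n)) y < ε := by
  choose! step hs using fun (k : ℕ) (hk : d (ballCenter a k) y < ballRadius k) =>
    exists_ballLT hd ha hk
  let t : ℕ → ℕ := fun i => Nat.rec (p n) (fun i k => step k (n + (i + 1))) i
  have ht0 : t 0 = p n := rfl
  have hts : ∀ i, t (i + 1) = step (t i) (n + (i + 1)) := fun _ => rfl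
  have hty : ∀ i, d (ballCenter a (t i)) y < ballRadius (t i) := fun i => by
    induction i with
    | zero => exact hy
    | succ i ih => exact (hs _ ih _).2.2.1
  have htr : ∀ i, ballRadius (t i) ≤ (1 / 2) ^ (n + i) := fun i => by
    cases i with
    | zero => exact hr n le_rfl
    | succ i => exact (hs _ (hty i) _).2.1
  let q : Baire := fun i => if i ≤ n then p i else t (i - n)
  have hq1 : ∀ i ≤ n, q i = p i := fun i hi => if_pos hi
  have hq2 : ∀ i, q (n + i) = t i := fun i => by
    cases i with
    | zero => exact hq1 n le_rfl
    | succ i =>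
      simp [q]
  have hq : q ∈ shrinkingBalls d a := fun i => by
    rcases lt_or_ge i n with hi | hi
    · rw [hq1 i hi.le, hq1 (i + 1) hi]
      exact ⟨hp i hi, hr i hi.le⟩
    · obtain ⟨j, rfl⟩ := Nat.exists_eq_add_of_le hi
      rw [add_assoc, hq2, hq2]
      exact ⟨(hs _ (hty j) _).1, htr j⟩
  refine ⟨q, hq, hq1, fun ε hε => ?_⟩
  obtain ⟨N, hN⟩ := exists_ballRadius_lt hq hε
  -- Index `n` itself is skipped: for `p n` only the distance from the centre to `y` is controlled,
  -- for later terms both distances are.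
  refine ⟨n + N + 1, fun m hm => ?_⟩
  obtain ⟨j, rfl⟩ : ∃ j, m = n + (j + 1) := ⟨m - n - 1, by omega⟩
  have h1 := hN (n + (j + 1)) (by omega)
  rw [hq2] at h1 ⊢
  exact ⟨lt_trans (hs _ (hty j) _).2.2.2 h1, lt_trans (hty (j + 1)) h1⟩

end shrinkingBalls

/-- A nonempty quasi-Polish space is the image of a closed subset of Baire space under an
open continuous map. -/
theorem IsQuasiPolish.exists_isOpenMap {X : Type u} [TopologicalSpace X] [Nonempty X]
    (hX : IsQuasiPolish X) :
    ∃ (D : Set Baire) (δ : D → X), IsClosed D ∧ Continuous δ ∧ IsOpenMap δ ∧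
      Function.Surjective δ := by
  obtain ⟨hsc, d, hd, ht, hS⟩ := hX
  obtain ⟨a, ha⟩ := hd.exists_denseSeq ht
  choose δ hδ using fun p : shrinkingBalls d a => exists_tendsto_ballCenter hd hS p.2
  have hlt := fun p : shrinkingBalls d a => dist_limit_lt_ballRadius hd p.2 (hδ p)
  have huniq : ∀ (p : shrinkingBalls d a) (y : X),
      (∀ ε > 0, ∃ N, ∀ n ≥ N, d y (ballCenter a (p.1 n)) < ε ∧ d (ballCenter a (p.1 n)) y < ε) →
      δ p = y := fun p y hy => by
    refine (hd.eq_iff _ _).2 ⟨?_, ?_⟩ <;>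
      refine le_antisymm (le_of_forall_pos_le_add fun ε hε => ?_) (hd.nonneg _ _) <;>
      obtain ⟨N, hN⟩ := hδ p _ (half_pos hε) <;>
      obtain ⟨M, hM⟩ := hy _ (half_pos hε) <;>
      have h1 := hN (max N M) (le_max_left _ _) <;>
      have h2 := hM (max N M) (le_max_right _ _)
    · linarith [hd.triangle (δ p) (ballCenter a (p.1 (max N M))) y]
    · linarith [hd.triangle y (ballCenter a (p.1 (max N M))) (δ p)]
  have hext : ∀ (p : Baire) (n : ℕ) (y : X), (∀ i < n, BallLT d a (p i) (p (i + 1))) →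
      (∀ i ≤ n, ballRadius (p i) ≤ (1 / 2) ^ i) → d (ballCenter a (p n)) y < ballRadius (p n) →
      ∃ q : shrinkingBalls d a, (∀ i ≤ n, q.1 i = p i) ∧ δ q = y := fun p n y h1 h2 h3 => by
    obtain ⟨q, hq, hqp, hqy⟩ := exists_extension_shrinkingBalls hd ha h1 h2 h3
    exact ⟨⟨q, hq⟩, hqp, huniq _ _ hqy⟩
  refine ⟨shrinkingBalls d a, δ, isClosed_shrinkingBalls d a, ?_, ?_, fun y => ?_⟩
  · refine continuous_def.2 fun U hU => isOpen_iff_mem_nhds.2 fun p hp => ?_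
    obtain ⟨ε, hε, hsub⟩ := (ht.isOpen_iff hd).1 hU _ hp
    -- At a late index the centre is `ε / 2`-close to `δ p` and the radius is below `ε / 2`; any `q`
    -- sharing that one entry has its limit in the same formal ball.
    obtain ⟨N, hN⟩ := hδ p _ (half_pos hε)
    obtain ⟨M, hM⟩ := exists_ballRadius_lt p.2 (half_pos hε)
    have h1 := (hN (max N M) (le_max_left _ _)).1
    have h2 := hM (max N M) (le_max_right _ _)
    have hop : IsOpen {q : shrinkingBalls d a | q.1 (max N M) = p.1 (max N M)} :=
      isOpen_discrete {p.1 (max N M)} |>.preimage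
        (Continuous.comp (g := fun r : Baire => r (max N M)) (continuous_apply _)
          continuous_subtype_val)
    filter_upwards [hop.mem_nhds rfl] with q hq
    have h3 := hlt q (max N M)
    rw [hq] at h3
    have := hd.triangle (δ p) (ballCenter a (p.1 (max N M))) (δ q)
    exact hsub (show d (δ p) (δ q) < ε by linarith)
  · intro W hW
    refine (ht.isOpen_iff hd).2 ?_
    rintro _ ⟨p, hp, rfl⟩
    obtain ⟨V, hV, rfl⟩ := hW
    obtain ⟨_, ⟨z, n, rfl⟩, hz, hsub⟩ :=
      (PiNat.isTopologicalBasis_cylinders (fun _ => ℕ)).exists_subset_of_mem_open hp hV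
    -- With this radius the ball about `δ p` stays inside the `n`-th formal ball of `p`, so each of
    -- its points is the limit of a sequence agreeing with `p` up to `n`.
    refine ⟨ballRadius (p.1 n) - d (ballCenter a (p.1 n)) (δ p), sub_pos.2 (hlt p n),
      fun y hy => ?_⟩
    obtain ⟨q, hq, rfl⟩ := hext p.1 n y (fun i _ => (p.2 i).1) (fun i _ => (p.2 i).2) (by
      have := hd.triangle (ballCenter a (p.1 n)) (δ p) y
      rw [mem_ofPred_eq] at hy
      linarith)
    refine ⟨q, hsub ?_, rfl⟩
    rw [PiNat.mem_cylinder_iff] at hz ⊢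
    exact fun i hi => (hq i hi.le).trans (hz i hi)
  · obtain ⟨i, -, hi⟩ := ha y 1 one_pos
    have hr : ballRadius (Nat.pair i 0) = 1 := by simp [ballRadius]
    obtain ⟨q, -, hq⟩ := hext (fun _ => Nat.pair i 0) 0 y (by simp)
      (fun j hj => by obtain rfl := Nat.le_zero.1 hj; simp [hr])
      (by simpa [hr, ballCenter] using hi)
    exact ⟨q, hq⟩

/-! ### Levels of discontinuity -/

section discLevel

variable {X : Type u} {Y : Type v} [TopologicalSpace X] [TopologicalSpace Y]

theorem discLevel_zero (f : X → Y) : discLevel f 0 = univ :=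
  Ordinal.limitRecOn_zero ..

theorem discLevel_add_one (f : X → Y) (α : Ordinal.{u}) :
    discLevel f (α + 1) =
      closure {x | x ∈ discLevel f α ∧ ¬ ContinuousWithinAt f (discLevel f α) x} :=
  Ordinal.limitRecOn_add_one ..

theorem discLevel_limit (f : X → Y) {α : Ordinal.{u}} (hα : Order.IsSuccLimit α) :
    discLevel f α = ⋂ (β : Ordinal.{u}) (_ : β < α), discLevel f β :=
  Ordinal.limitRecOn_limit _ _ _ _ hα

theorem isClosed_discLevel (f : X → Y) (α : Ordinal.{u}) : IsClosed (discLevel f α) := by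
  induction α using Ordinal.limitRecOn with
  | zero => rw [discLevel_zero]; exact isClosed_univ
  | add_one α _ => rw [discLevel_add_one]; exact isClosed_closure
  | limit α hα ih => rw [discLevel_limit f hα]; exact isClosed_biInter ih

theorem discLevel_add_one_subset (f : X → Y) (α : Ordinal.{u}) :
    discLevel f (α + 1) ⊆ discLevel f α := by
  rw [discLevel_add_one]
  exact closure_minimal (fun x hx => hx.1) (isClosed_discLevel f α)

theorem discLevel_anti (f : X → Y) : Antitone (discLevel f) := by
  intro β α h
  induction α using Ordinal.limitRecOn with
  | zero => rw [nonpos_iff_eq_zero.1 h]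
  | add_one α ih =>
    rcases h.eq_or_lt with rfl | h
    · exact Subset.rfl
    · exact (discLevel_add_one_subset f α).trans (ih (Order.lt_add_one_iff.1 h))
  | limit α hα _ =>
    rcases h.eq_or_lt with rfl | h
    · exact Subset.rfl
    · rw [discLevel_limit f hα]
      exact biInter_subset_of_mem h

/-- A point outside some level leaves the levels at a successor step. -/
theorem exists_mem_discLevel_diff (f : X → Y) {α : Ordinal.{u}} {x : X}
    (hx : x ∉ discLevel f α) : ∃ γ < α, x ∈ discLevel f γ ∧ x ∉ discLevel f (γ + 1) := by
  induction α using Ordinal.limitRecOn with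
  | zero => simp [discLevel_zero] at hx
  | add_one α ih =>
    by_cases h : x ∈ discLevel f α
    · exact ⟨α, Order.lt_add_one_iff.2 le_rfl, h, hx⟩
    · obtain ⟨γ, hγ, h⟩ := ih h
      exact ⟨γ, hγ.trans (Order.lt_add_one_iff.2 le_rfl), h⟩
  | limit α hα ih =>
    rw [discLevel_limit f hα] at hx
    simp only [mem_iInter, not_forall] at hx
    obtain ⟨β, hβ, hx⟩ := hx
    obtain ⟨γ, hγ, h⟩ := ih β hβ hx
    exact ⟨γ, hγ.trans hβ, h⟩

theorem continuousWithinAt_discLevel (f : X → Y) {α : Ordinal.{u}} {x : X}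
    (hx : x ∈ discLevel f α) (hx' : x ∉ discLevel f (α + 1)) :
    ContinuousWithinAt f (discLevel f α) x := by
  by_contra h
  rw [discLevel_add_one] at hx'
  exact hx' (subset_closure ⟨hx, h⟩)

theorem continuousOn_discLevel_diff (f : X → Y) (α : Ordinal.{u}) :
    ContinuousOn f (discLevel f α \ discLevel f (α + 1)) := fun _ hx =>
  (continuousWithinAt_discLevel f hx.1 hx.2).mono sdiff_subset

/-- In a countably based space, the levels become stationary at some countable ordinal. -/
theorem exists_discLevel_add_one_eq [SecondCountableTopology X] (f : X → Y) :
    ∃ α < Ordinal.omega.{u} 1, discLevel f (α + 1) = discLevel f α := by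
  by_contra! hne
  -- Each strict drop is witnessed by a basic open set meeting level `α` and missing level `α + 1`.
  -- Different drops need different sets, and there are only countably many.
  have key : ∀ α : Iio (Ordinal.omega.{u} 1), ∃ U : TopologicalSpace.countableBasis X,
      (∃ x ∈ (U : Set X), x ∈ discLevel f α) ∧ ∀ x ∈ (U : Set X), x ∉ discLevel f (α + 1) := by
    intro α
    obtain ⟨x, hx, hx'⟩ := exists_of_ssubset
      ((discLevel_add_one_subset f α).ssubset_of_ne (hne α α.2))
    obtain ⟨U, hU, hxU, hsub⟩ :=
      (TopologicalSpace.isBasis_countableBasis X).exists_subset_of_mem_open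
        (show x ∈ (discLevel f (α + 1))ᶜ from hx') (isClosed_discLevel f _).isOpen_compl
    exact ⟨⟨U, hU⟩, ⟨x, hxU, hx⟩, fun y hy => hsub hy⟩
  choose U hU hU' using key
  have hlt : ∀ α β, α < β → U α ≠ U β := fun α β h heq => by
    obtain ⟨x, hx, hxβ⟩ := hU β
    exact hU' α x (heq ▸ hx) (discLevel_anti f (Order.add_one_le_iff.2 h) hxβ)
  have hinj : Function.Injective U := fun α β h => by
    rcases lt_trichotomy α β with h1 | h1 | h1
    · exact absurd h (hlt α β h1)
    · exact h1
    · exact absurd h.symm (hlt β α h1)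
  have : Countable (TopologicalSpace.countableBasis X) :=
    (TopologicalSpace.countable_countableBasis X).to_subtype
  have hcount : Countable (Iio (Ordinal.omega.{u} 1)) := hinj.countable
  rw [← Cardinal.mk_le_aleph0_iff, Cardinal.mk_Iio_ordinal, Ordinal.card_omega,
    Cardinal.lift_le_aleph0] at hcount
  exact absurd hcount (not_le.2 Cardinal.aleph0_lt_aleph_one)

end discLevel

/-! ### `j_Δ`-realizable functions have countable level -/

/-- If the members of the sequences coded by `H p`, for `p` in a Baire space, are eventually constant,
then they are constant from a fixed index on, for all `p` in a nonempty open set. -/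
theorem exists_isOpen_forall_seqEntry_eq {D : Type u} [TopologicalSpace D] [BaireSpace D]
    [Nonempty D] {H : D → Baire} (hH : Continuous H)
    (h : ∀ p, ∃ n, ∀ m ≥ n, seqEntry (H p) m = seqEntry (H p) n) :
    ∃ (U : Set D) (n : ℕ), IsOpen U ∧ U.Nonempty ∧
      ∀ p ∈ U, ∀ m ≥ n, seqEntry (H p) m = seqEntry (H p) n := by
  have hcont : ∀ n, Continuous fun p => seqEntry (H p) n := fun n =>
    continuous_pi fun m => (continuous_apply (Nat.pair n m)).comp hH
  -- Baire category: the sets of `p` whose sequence is constant from `n` on are closed and cover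
  -- `D`.
  obtain ⟨n, hn⟩ := nonempty_interior_of_iUnion_of_closed
    (f := fun n => {p | ∀ m ≥ n, seqEntry (H p) m = seqEntry (H p) n})
    (fun n => by
      simp only [ofPred_forall]
      exact isClosed_iInter fun m => isClosed_iInter fun _ => isClosed_eq (hcont m) (hcont n))
    (eq_univ_of_forall fun p => mem_iUnion.2 (h p))
  exact ⟨_, n, isOpen_interior, hn, fun p hp => interior_subset hp⟩

/-- The restriction of a `j_Δ`-realizable function to a nonempty closed subspace of a quasi-Polish
space is continuous at all points of some nonempty relatively open set. -/
theorem JRealizable.exists_isOpen_continuousWithinAt {X : Type u} {Y : Type v} [TopologicalSpace X]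
    [TopologicalSpace Y] (hX : IsQuasiPolish X) {ρX : Baire →. X} (hρX : IsAdmissible ρX)
    {ρY : Baire →. Y} (hρY : PartialContinuous ρY) {f : X → Y}
    (hf : JRealizable ρX ρY jDelta (f : X →. Y)) {A : Set X} (hA : IsClosed A)
    (hne : A.Nonempty) :
    ∃ V : Set X, IsOpen V ∧ (A ∩ V).Nonempty ∧ ∀ x ∈ A ∩ V, ContinuousWithinAt f A x := by
  have : Nonempty A := hne.to_subtype
  obtain ⟨D, δ, hD, hδ, hδo, hδs⟩ := (hX.of_isClosed hA).exists_isOpenMap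
  obtain ⟨G, hG, hGδ⟩ := hρX.exists_lift (continuous_subtype_val.comp hδ)
  obtain ⟨F, hF, hFj⟩ := hf.exists_realizer
  have hdom : ∀ p, G p ∈ ρX.Dom := fun p => (ρX.mem_dom _).2 ⟨_, hGδ p⟩
  let H : D → Baire := fun p => F ⟨G p, hdom p⟩
  have hH : Continuous H := hF.comp (hG.subtype_mk _)
  have hHj : ∀ p, ∃ r ∈ jDelta (H p), f (δ p) ∈ ρY r := fun p => by
    obtain ⟨r, hr, hy⟩ := hFj ⟨G p, hdom p⟩
    rw [PFun.asSubtype_eq_of_mem (hGδ p)] at hy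
    exact ⟨r, hr, hy⟩
  have : PolishSpace D := hD.polishSpace
  have : Nonempty D := (hδs (Classical.arbitrary A)).nonempty
  have : BaireSpace D := by
    let _ := TopologicalSpace.upgradeIsCompletelyMetrizable D
    infer_instance
  obtain ⟨U, n, hUo, ⟨p₀, hp₀⟩, hU⟩ := exists_isOpen_forall_seqEntry_eq hH fun p => by
    obtain ⟨r, hr, -⟩ := hHj p
    obtain ⟨n, hn⟩ := mem_jDelta.1 hr
    exact ⟨n, fun m hm => (hn m hm).trans (hn n le_rfl).symm⟩
  -- On `U` the limit is already entry `n`, which depends continuously on `p`.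
  have hval : ∀ p ∈ U, f (δ p) ∈ ρY (seqEntry (H p) n) := fun p hp => by
    obtain ⟨r, hr, hy⟩ := hHj p
    obtain ⟨N, hN⟩ := mem_jDelta.1 hr
    rwa [← hU p hp _ (le_max_left n N), hN _ (le_max_right n N)]
  have hcont : ContinuousOn (fun p => f (δ p)) U := by
    rw [continuousOn_iff_continuous_domRestrict]
    have hd : ∀ p : U, seqEntry (H p) n ∈ ρY.Dom := fun p => (ρY.mem_dom _).2 ⟨_, hval p p.2⟩
    have h1 : Continuous fun p : U => (⟨seqEntry (H p) n, hd p⟩ : ρY.Dom) :=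
      Continuous.subtype_mk (continuous_pi fun m =>
        (continuous_apply (Nat.pair n m)).comp (hH.comp continuous_subtype_val)) _
    refine (hρY.comp h1).congr fun p => ?_
    exact (PFun.asSubtype_eq_of_mem (hval p p.2) (hd p))
  obtain ⟨V, hV, hVU⟩ := hδo U hUo
  refine ⟨V, hV, ⟨δ p₀, (δ p₀).2, ?_⟩, ?_⟩
  · have : δ p₀ ∈ Subtype.val ⁻¹' V := hVU ▸ mem_image_of_mem δ hp₀
    exact this
  · rintro x ⟨hxA, hxV⟩
    obtain ⟨p, hp, hpx⟩ : (⟨x, hxA⟩ : A) ∈ δ '' U := hVU ▸ hxV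
    rw [continuousWithinAt_iff_continuousAt_domRestrict f hxA, ← hpx]
    intro W hW
    -- The image of this neighbourhood under the open map `δ` is a neighbourhood in `A` that `f`
    -- sends into `W`.
    have h1 : {q | f (δ q) ∈ W} ∈ 𝓝 p := (hcont.continuousAt (hUo.mem_nhds hp)) hW
    rw [mem_map]
    exact mem_of_superset (hδo.image_mem_nhds h1) (image_subset_iff.2 fun q hq => hq)

theorem Lev_eq_coe_iff {X : Type u} {Y : Type v} [TopologicalSpace X] [TopologicalSpace Y]
    {f : X → Y} {α : Ordinal.{u}} :
    Lev f = α ↔ IsLeast {α | discLevel f α = ∅} α := by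
  unfold Lev
  split_ifs with h
  · rw [WithTop.coe_inj]
    exact ⟨fun h' => h' ▸ ⟨csInf_mem h, fun _ => csInf_le'⟩, fun h' => h'.csInf_eq⟩
  · exact ⟨fun h' => absurd h' (by simp), fun h' => absurd ⟨α, h'.1⟩ h⟩

/-- A nonempty stationary level would be the closure of its own discontinuity points, which must
therefore meet the relatively open set where `f` is continuous. -/
theorem JRealizable.exists_discLevel_eq_empty {X : Type u} {Y : Type v} [TopologicalSpace X]
    [TopologicalSpace Y] (hX : IsQuasiPolish X) {ρX : Baire →. X} (hρX : IsAdmissible ρX)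
    {ρY : Baire →. Y} (hρY : PartialContinuous ρY) {f : X → Y}
    (hf : JRealizable ρX ρY jDelta (f : X →. Y)) :
    ∃ α < Ordinal.omega.{u} 1, discLevel f α = ∅ := by
  have := hX.secondCountable
  obtain ⟨α, hα, heq⟩ := exists_discLevel_add_one_eq f
  refine ⟨α, hα, not_nonempty_iff_eq_empty.1 fun hne => ?_⟩
  obtain ⟨V, hV, ⟨x, hxA, hxV⟩, hc⟩ :=
    hf.exists_isOpen_continuousWithinAt hX hρX hρY (isClosed_discLevel f α) hne
  rw [← heq, discLevel_add_one] at hxA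
  obtain ⟨y, hyV, hy, hyc⟩ := mem_closure_iff.1 hxA V hV hxV
  exact hyc (hc y ⟨hy, hyV⟩)

/-! ### Extension of continuous functions on subsets of Baire space -/

/-- A continuous function on `K` extends to a function on Baire space that is continuous at all points
of `K` and at all points outside the closure of `K`. -/
theorem exists_extension_continuousAt {K : Set Baire} {φ : K → Baire} (hφ : Continuous φ) :
    ∃ ψ : Baire → Baire, (∀ p : K, ψ p = φ p) ∧
      ∀ p, (p ∈ closure K → p ∈ K) → ContinuousAt ψ p := by
  classical
  -- Digit `m` of `φ` is constant on `K ∩ S`. This is vacuous when `S` misses `K`; then `c m S` is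
  -- an arbitrary value, but one depending on `m` and `S` alone.
  let P : ℕ → Set Baire → Prop := fun m S => ∃ v, ∀ r : K, r.1 ∈ S → φ r m = v
  let c : ℕ → Set Baire → ℕ := fun m S => if h : P m S then h.choose else 0
  have hc : ∀ m S, P m S → ∀ r : K, r.1 ∈ S → φ r m = c m S := fun m S h r hr => by
    rw [show c m S = h.choose from dif_pos h]
    exact h.choose_spec r hr
  let N : Baire → ℕ → ℕ := fun p m => sInf {n | P m (PiNat.cylinder p n)}
  have hN : ∀ {p m n}, P m (PiNat.cylinder p n) → P m (PiNat.cylinder p (N p m)) :=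
    fun {p m n} h => Nat.sInf_mem (s := {n | P m (PiNat.cylinder p n)}) ⟨n, h⟩
  let ψ : Baire → Baire := fun p m => c m (PiNat.cylinder p (N p m))
  have hcyl : ∀ {p q : Baire} {n i : ℕ}, q ∈ PiNat.cylinder p n → i ≤ n →
      PiNat.cylinder q i = PiNat.cylinder p i := fun hq hi =>
    PiNat.mem_cylinder_iff_eq.1 (PiNat.cylinder_anti _ hi hq)
  -- `N p m` is the shortest deciding prefix length; minimality makes points of one deciding
  -- cylinder use the same shorter cylinder, hence the same digit.
  have hloc : ∀ p q m n, P m (PiNat.cylinder p n) → q ∈ PiNat.cylinder p n → ψ q m = ψ p m := by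
    intro p q m n hn hq
    have hNp : N p m ≤ n := Nat.sInf_le hn
    have hPp : P m (PiNat.cylinder p (N p m)) := hN hn
    have hNqp : N q m ≤ N p m := Nat.sInf_le (show P m _ by rwa [hcyl hq hNp])
    have hPq : P m (PiNat.cylinder q (N q m)) :=
      hN (n := n) (by rwa [hcyl hq le_rfl])
    have hNpq : N p m ≤ N q m :=
      Nat.sInf_le (show P m _ by rwa [← hcyl hq (hNqp.trans hNp)])
    change c m (PiNat.cylinder q (N q m)) = c m (PiNat.cylinder p (N p m))
    rw [le_antisymm hNqp hNpq, hcyl hq hNp]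
  have hex : ∀ p, (p ∈ closure K → p ∈ K) → ∀ m, ∃ n, P m (PiNat.cylinder p n) := by
    intro p hp m
    by_cases h : p ∈ closure K
    · have hop : IsOpen {r : K | φ r m = φ ⟨p, hp h⟩ m} :=
        (isOpen_discrete {φ ⟨p, hp h⟩ m}).preimage
          (Continuous.comp (g := fun r : Baire => r m) (continuous_apply _) hφ)
      obtain ⟨V, hV, hVeq⟩ := hop
      have hpV : (⟨p, hp h⟩ : K) ∈ Subtype.val ⁻¹' V := hVeq ▸ rfl
      obtain ⟨_, ⟨z, n, rfl⟩, hz, hsub⟩ :=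
        (PiNat.isTopologicalBasis_cylinders (fun _ => ℕ)).exists_subset_of_mem_open hpV hV
      refine ⟨n, φ ⟨p, hp h⟩ m, fun r hr => ?_⟩
      have h1 : r ∈ Subtype.val ⁻¹' V := hsub (PiNat.mem_cylinder_iff_eq.1 hz ▸ hr)
      rwa [hVeq] at h1
    · obtain ⟨n, hn⟩ := PiNat.exists_disjoint_cylinder isClosed_closure h
      exact ⟨n, 0, fun r hr => absurd hr (hn.notMem_of_mem_left (subset_closure r.2))⟩
  refine ⟨ψ, fun p => funext fun m => ?_, fun p hp => tendsto_pi_nhds.2 fun m => ?_⟩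
  · exact (hc m _ ((hex p (fun _ => p.2) m).elim fun _ => hN) p
      (PiNat.self_mem_cylinder _ _)).symm
  · obtain ⟨n, hn⟩ := hex p hp m
    refine tendsto_const_nhds.congr' ?_
    filter_upwards [(PiNat.isOpen_cylinder _ p n).mem_nhds (PiNat.self_mem_cylinder p n)] with q hq
    exact (hloc p q m n hn hq).symm

/-! ### Functions of countable level are `j_α`-realizable -/

/-- A realizer of the restriction of `f` to the difference of two successive levels that is continuous at
all names of points outside the second one. -/
theorem IsAdmissible.exists_realizer_discLevel {X : Type u} {Y : Type v} [TopologicalSpace X]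
    [TopologicalSpace Y] {ρX : Baire →. X} (hρX : PartialContinuous ρX) {ρY : Baire →. Y}
    (hρY : IsAdmissible ρY) (f : X → Y) (γ : Ordinal.{u}) :
    ∃ ψ : Baire → Baire,
      (∀ p : ρX.Dom, ρX.asSubtype p ∈ discLevel f γ → ρX.asSubtype p ∉ discLevel f (γ + 1) →
        f (ρX.asSubtype p) ∈ ρY (ψ p)) ∧
      ∀ p : ρX.Dom, ρX.asSubtype p ∉ discLevel f (γ + 1) → ContinuousAt ψ p := by
  let L := discLevel f γ \ discLevel f (γ + 1)
  let K : Set Baire := Subtype.val '' (ρX.asSubtype ⁻¹' L)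
  have hK : ∀ p : K, ∃ h : p.1 ∈ ρX.Dom, ρX.asSubtype ⟨p, h⟩ ∈ L := by
    rintro ⟨_, p, hp, rfl⟩
    exact ⟨p.2, hp⟩
  choose hdom hL using hK
  have hg : Continuous fun p : K => f (ρX.asSubtype ⟨p, hdom p⟩) :=
    (continuousOn_discLevel_diff f γ).comp_continuous
      (hρX.comp (continuous_subtype_val.subtype_mk hdom)) hL
  obtain ⟨φ, hφ, hφY⟩ := hρY.exists_lift hg
  obtain ⟨ψ, hψ, hψc⟩ := exists_extension_continuousAt hφ
  have hmem : ∀ p : ρX.Dom, ρX.asSubtype p ∈ L → p.1 ∈ K := fun p hp => ⟨p, hp, rfl⟩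
  refine ⟨ψ, fun p h1 h2 => ?_, fun p h => hψc p fun hpK => ?_⟩
  · have := hφY ⟨p, hmem p ⟨h1, h2⟩⟩
    rwa [← hψ] at this
  -- Level `γ` is closed, so its names form a relatively closed subset of the domain of `ρX`; a
  -- limit of names in `K` thus names a point of level `γ`.
  · refine hmem p ⟨?_, h⟩
    have h1 : p ∈ closure (ρX.asSubtype ⁻¹' L) := by
      rwa [Topology.IsInducing.subtypeVal.closure_eq_preimage_closure_image]
    exact closure_minimal (preimage_mono sdiff_subset)
      ((isClosed_discLevel f γ).preimage hρX) h1

/-- The least ordinal `γ` for which the first `n` entries of `p` witness that the point named by `p` is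
not in the level `γ + 1` of `f`. -/
noncomputable def levelGuess {X : Type u} {Y : Type v} [TopologicalSpace X] [TopologicalSpace Y]
    (ρX : Baire →. X) (f : X → Y) (p : Baire) (n : ℕ) : Ordinal.{u} :=
  sInf {γ | ∀ q : ρX.Dom, q.1 ∈ PiNat.cylinder p n → ρX.asSubtype q ∉ discLevel f (γ + 1)}

/-! ### Guessing the level from prefixes, and the resulting realizer. -/

section levelGuess

variable {X : Type u} {Y : Type v} [TopologicalSpace X] [TopologicalSpace Y] {ρX : Baire →. X}
  {f : X → Y} {α : Ordinal.{u}}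

theorem notMem_discLevel_add_one (h : discLevel f α = ∅) (x : X) : x ∉ discLevel f (α + 1) :=
  fun hx => notMem_empty x (h ▸ discLevel_add_one_subset f α hx)

theorem levelGuess_le (h : discLevel f α = ∅) (p : Baire) (n : ℕ) : levelGuess ρX f p n ≤ α :=
  csInf_le' fun _ _ => notMem_discLevel_add_one h _

theorem notMem_discLevel_levelGuess (h : discLevel f α = ∅) (p : Baire) (n : ℕ) (q : ρX.Dom)
    (hq : q.1 ∈ PiNat.cylinder p n) :
    ρX.asSubtype q ∉ discLevel f (levelGuess ρX f p n + 1) :=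
  csInf_mem (s := {γ | ∀ q : ρX.Dom, q.1 ∈ PiNat.cylinder p n →
    ρX.asSubtype q ∉ discLevel f (γ + 1)}) ⟨α, fun _ _ => notMem_discLevel_add_one h _⟩ q hq

theorem antitone_levelGuess (h : discLevel f α = ∅) (p : Baire) :
    Antitone (levelGuess ρX f p) := fun n _ hm =>
  csInf_le' fun q hq => notMem_discLevel_levelGuess h p n q (PiNat.cylinder_anti p hm hq)

/-- This makes each stage of the guess locally constant, hence continuous into the discrete codes.
-/
theorem levelGuess_congr {p q : Baire} {n : ℕ} (hq : q ∈ PiNat.cylinder p n) :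
    levelGuess ρX f q n = levelGuess ρX f p n := by
  unfold levelGuess
  rw [PiNat.mem_cylinder_iff_eq.1 hq]

/-- The complement of level `γ + 1` has a relatively open set of names, so some prefix already
excludes that level. No smaller guess can occur, since `p` lies in all its own cylinders. -/
theorem exists_forall_levelGuess_eq (hρX : PartialContinuous ρX) (h : discLevel f α = ∅)
    (p : ρX.Dom) {γ : Ordinal.{u}} (hγ : ρX.asSubtype p ∈ discLevel f γ)
    (hγ' : ρX.asSubtype p ∉ discLevel f (γ + 1)) :
    ∃ n, ∀ m ≥ n, levelGuess ρX f p m = γ := by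
  obtain ⟨V, hV, hVeq⟩ := ((isClosed_discLevel f (γ + 1)).isOpen_compl).preimage hρX
  have hpV : p ∈ Subtype.val ⁻¹' V := hVeq ▸ hγ'
  obtain ⟨_, ⟨z, n, rfl⟩, hz, hsub⟩ :=
    (PiNat.isTopologicalBasis_cylinders (fun _ => ℕ)).exists_subset_of_mem_open hpV hV
  rw [← PiNat.mem_cylinder_iff_eq.1 hz] at hsub
  refine ⟨n, fun m hm => le_antisymm (csInf_le' fun q hq => ?_) (not_lt.1 fun hlt => ?_)⟩
  · have h1 : q ∈ Subtype.val ⁻¹' V := hsub (PiNat.cylinder_anti _ hm hq)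
    rw [hVeq] at h1
    exact h1
  · exact notMem_discLevel_levelGuess h p m p (PiNat.self_mem_cylinder _ _)
      (discLevel_anti f (Order.add_one_le_iff.2 hlt) hγ)

/-- The index is `α + 1` because the guesses are bounded only by `α` inclusive. Equal consecutive
guesses give the same `ψ` at the same `p`, so the approximation changes only when the guess drops.
-/
theorem jRealizable_jOrd_of_discLevel_eq_empty (hρX : PartialContinuous ρX) {ρY : Baire →. Y}
    (hρY : IsAdmissible ρY) (h : discLevel f α = ∅) (e : Iio (α + 1) ↪ ℕ) :
    JRealizable ρX ρY (jOrd e) (f : X →. Y) := by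
  choose ψ hψ hψc using hρY.exists_realizer_discLevel hρX f
  let β : Baire → ℕ → Iio (α + 1) := fun p n =>
    ⟨levelGuess ρX f p n, Order.lt_add_one_iff.2 (levelGuess_le h p n)⟩
  have hloc : ∀ (p : ρX.Dom) (n : ℕ), ∀ᶠ q : ρX.Dom in 𝓝 p, β q n = β p n := fun p n => by
    have h1 : IsOpen ((↑) ⁻¹' PiNat.cylinder p.1 n : Set ρX.Dom) :=
      (PiNat.isOpen_cylinder _ p.1 n).preimage continuous_subtype_val
    filter_upwards [h1.mem_nhds (PiNat.self_mem_cylinder p.1 n)] with q hq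
    exact Subtype.ext (levelGuess_congr hq)
  refine jRealizable_of_realizer (G := fun p =>
    codeSeq (fun n => e (β p n)) fun n => ψ (levelGuess ρX f p n) p)
    (continuous_codeSeq (fun n => ?_) fun n => ?_) fun p => ?_
  · refine continuous_iff_continuousAt.2 fun p => tendsto_const_nhds.congr' ?_
    filter_upwards [hloc p n] with q hq
    rw [hq]
  · refine continuous_iff_continuousAt.2 fun p => ?_
    have h1 : ContinuousAt (fun q : ρX.Dom => ψ (levelGuess ρX f p n) q) p :=
      (hψc _ p (notMem_discLevel_levelGuess h p n p
        (PiNat.self_mem_cylinder _ _))).comp continuous_subtype_val.continuousAt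
    refine h1.congr ?_
    filter_upwards [hloc p n] with q hq
    rw [show levelGuess ρX f q n = levelGuess ρX f p n from congrArg Subtype.val hq]
  · obtain ⟨γ, -, hγ, hγ'⟩ := exists_mem_discLevel_diff f (h ▸ notMem_empty (ρX.asSubtype p))
    obtain ⟨n, hn⟩ := exists_forall_levelGuess_eq hρX h p hγ hγ'
    refine ⟨ψ γ p, mem_jOrd_codeSeq (n := n) ?_ ?_ fun m hm => ?_, hψ γ p hγ hγ'⟩
    · exact fun m n hmn => antitone_levelGuess h p hmn
    · intro m hm
      rw [show levelGuess ρX f p m = levelGuess ρX f p (m + 1) from congrArg Subtype.val hm]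
    · rw [hn m hm]

end levelGuess

/-! ### The two equivalences. -/

theorem theorem31 {X : Type u} {Y : Type v} [TopologicalSpace X] [TopologicalSpace Y]
    (hX : IsQuasiPolish X) [SecondCountableTopology Y] [T0Space Y]
    (ρX : Baire →. X) (hρX : IsAdmissible ρX) (ρY : Baire →. Y) (hρY : IsAdmissible ρY)
    (enc : ∀ α : Ordinal.{u}, α < Ordinal.omega 1 → (Set.Iio α ↪ ℕ))
    (f : X → Y) :
    (JRealizable ρX ρY jDelta (f : X →. Y) ↔
      ∃ (α : Ordinal.{u}) (hα : α < Ordinal.omega 1),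
        JRealizable ρX ρY (jOrd (enc α hα)) (f : X →. Y)) ∧
    (JRealizable ρX ρY jDelta (f : X →. Y) ↔
      ∃ α : Ordinal.{u}, α < Ordinal.omega 1 ∧ Lev f = (α : WithTop Ordinal.{u})) := by
  have h1 : (∃ α < Ordinal.omega.{u} 1, discLevel f α = ∅) →
      ∃ (α : Ordinal.{u}) (hα : α < Ordinal.omega 1),
        JRealizable ρX ρY (jOrd (enc α hα)) (f : X →. Y) := fun ⟨α, hα, h⟩ =>
    -- The shift by one stays countable because `ω₁` is a limit ordinal.
    ⟨α + 1, (Cardinal.isSuccLimit_omega 1).add_one_lt hα,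
      jRealizable_jOrd_of_discLevel_eq_empty hρX.continuous hρY h _⟩
  have h2 : JRealizable ρX ρY jDelta (f : X →. Y) → ∃ α < Ordinal.omega.{u} 1, discLevel f α = ∅ :=
    fun h => h.exists_discLevel_eq_empty hX hρX hρY.continuous
  refine ⟨⟨fun h => h1 (h2 h), fun ⟨_, _, h⟩ => h.jDelta_of_jOrd⟩, fun h => ?_, ?_⟩
  · obtain ⟨α, hα, h⟩ := h2 h
    have hleast := isLeast_csInf (s := {α | discLevel f α = ∅}) ⟨α, h⟩
    exact ⟨_, (hleast.2 h).trans_lt hα, Lev_eq_coe_iff.2 hleast⟩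
  · rintro ⟨α, hα, h⟩
    obtain ⟨_, _, h⟩ := h1 ⟨α, hα, (Lev_eq_coe_iff.1 h).1⟩
    exact h.jDelta_of_jOrd
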